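/- Let $H$ be a complex Hilbert space with an orthonormal basis $(e_m)_{m\in\mathbb N}$, let $\lambda_m>0$ for all $m$, and let $T$ be the diagonal operator with entries $\lambda_m$, i.e. $T\big(\sum_m x_m e_m\big)=\sum_m \lambda_m x_m e_m$ for all $\sum_m x_m e_m\in H$ with $\sum_m|\lambda_m x_m|^2<\infty$ ($T$ need not be bounded). Let $\alpha$ satisfy $\frac1{\sqrt2}<\alpha<1$. Suppose that for each $k\ge1$ there are real numbers $0<c_k\le d_k$ and a set $\Delta_k=\{n^k_1,n^k_2,\dots,n^k_{2^k}\}\subset\mathbb N$ of $2^k$ distinct indices such that a) $\sup_{k\ge1} d_k/c_k<\infty$; b) for every $k\ge1$, $$c_k\le\frac{\alpha^k}{\lambda_{n^k_{2^k-1}}}\le d_k,\qquad c_k\le\frac{\alpha^k}{\lambda_{n^k_{2^k}}}\le d_k,$$ and, whenever $1\le j\le k-1$ and $2^k\big(1-\frac1{2^{j-1}}\big)+1\le i\le 2^k\big(1-\frac1{2^j}\big)$, $$c_k\le\frac{\alpha^j}{\lambda_{n^k_i}}\le d_k;$$ c) $\max\Delta_k<\min\Delta_{k'}$ whenever $1\le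 k<k'$. Then $T$ is a conditional operator: there is an orthonormal basis $(g_n)$ of $H$, contained in the domain of $T$, such that $(Tg_n)$ is a conditional basis of $H$. Here a sequence $(f_n)$ in $H$ is a Schauder basis if every $x\in H$ has a unique expansion $x=\sum_{n} a_n f_n$ whose partial sums converge to $x$ in norm; it is unconditional if all these expansions converge unconditionally, and conditional otherwise. -/

import Mathlib

noncomputable section

variable {H : Type*} [NormedAddCommGroup H] [InnerProductSpace ℂ H]

/-- The sequence `f` is a Schauder basis of `H`: every vector has a unique norm-convergent
expansion `∑ aₙ fₙ` (partial sums taken in the natural order), with continuous coordinates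
(continuity is automatic in a Hilbert space). -/
def IsSchauderBasis (f : ℕ → H) : Prop :=
  ∃ b : SchauderBasis ℂ H, b.basis = f

/-- The sequence `f` is an unconditional basis of `H`: moreover, all the expansions converge
unconditionally. -/
def IsUnconditionalBasis (f : ℕ → H) : Prop :=
  ∃ b : UnconditionalSchauderBasis ℕ ℂ H, b.basis = f

/-- A conditional basis is a Schauder basis that is not unconditional. -/
def IsConditionalBasis (f : ℕ → H) : Prop :=
  IsSchauderBasis f ∧ ¬ IsUnconditionalBasis f

/-- A (possibly unbounded) operator `T` in `H` is a Schauder operator if it maps some orthonormal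
basis `b`, contained in its domain, to a Schauder basis. The coordinates of `T bₙ` with respect
to `b` form the `n`-th column of the matrix of `T` under `b`. -/
def IsSchauderOperator (T : H →ₗ.[ℂ] H) : Prop :=
  ∃ (b : HilbertBasis ℕ ℂ H) (hb : ∀ n, b n ∈ T.domain),
    IsSchauderBasis fun n => T ⟨b n, hb n⟩

/-- A Schauder operator is a conditional operator if it maps some orthonormal basis to a
conditional basis. -/
def IsConditionalOperator (T : H →ₗ.[ℂ] H) : Prop :=
  IsSchauderOperator T ∧
    ∃ (b : HilbertBasis ℕ ℂ H) (hb : ∀ n, b n ∈ T.domain),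
      IsConditionalBasis fun n => T ⟨b n, hb n⟩

/-- The maximal domain of the diagonal operator with entries `lam n` under `e`: the vectors
`∑ xₙ eₙ` for which `(lamₙ xₙ)` is square summable. -/
def diagonalDomain (e : HilbertBasis ℕ ℂ H) (lam : ℕ → ℂ) : Submodule ℂ H where
  carrier := {x | Memℓp (fun n => lam n * e.repr x n) 2}
  zero_mem' := by simpa using! (zero_memℓp : Memℓp (0 : ℕ → ℂ) 2)
  add_mem' := by
    intro x y hx hy
    simpa [mul_add] using! Memℓp.add hx hy
  smul_mem' := by
    intro a x hx
    have h := Memℓp.const_smul hx a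
    refine (congrArg (fun g : ℕ → ℂ => Memℓp g 2) ?_).mp h
    funext n
    simp [mul_left_comm]

/-- The diagonal operator with entries `lam n` under the orthonormal basis `e`, with its maximal
domain: it maps `∑ xₙ eₙ` to `∑ lamₙ xₙ eₙ`. -/
def diagonalOperator (e : HilbertBasis ℕ ℂ H) (lam : ℕ → ℂ) : H →ₗ.[ℂ] H where
  domain := diagonalDomain e lam
  toFun :=
    { toFun := fun x => e.repr.symm ⟨fun n => lam n * e.repr (x : H) n, x.2⟩
      map_add' := by
        intro x y
        rw [← LinearIsometryEquiv.map_add]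
        refine congrArg e.repr.symm (lp.ext (funext fun n => ?_))
        change lam n * e.repr ((x : H) + y) n = lam n * e.repr (x : H) n + lam n * e.repr (y : H) n
        rw [LinearIsometryEquiv.map_add, ← mul_add]
        rfl
      map_smul' := by
        intro a x
        rw [RingHom.id_apply, ← LinearIsometryEquiv.map_smul]
        refine congrArg e.repr.symm (lp.ext (funext fun n => ?_))
        change lam n * e.repr (a • (x : H)) n = a * (lam n * e.repr (x : H) n)
        rw [LinearIsometryEquiv.map_smul, mul_left_comm]
        rfl }

/-- A bounded operator that acts diagonally on `e` is the diagonal operator with its entries. -/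
theorem toPMap_eq_diagonalOperator (e : HilbertBasis ℕ ℂ H) (lam : ℕ → ℂ) (T : H →L[ℂ] H)
    (hT : ∀ n, T (e n) = lam n • e n) :
    (T : H →ₗ[ℂ] H).toPMap ⊤ = diagonalOperator e lam := by
  have key : ∀ x n, e.repr (T x) n = lam n * e.repr x n := by
    intro x n
    have h1 : HasSum (fun i => e.repr x i • e i) x := e.hasSum_repr x
    have h2 := (h1.mapL T).mapL (innerSL ℂ (e n))
    have h3 : HasSum (fun i => innerSL ℂ (e n) (T (e.repr x i • e i)))
        (e.repr x n * lam n) := by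
      convert hasSum_single n ?_ using 1
      · simp [hT, e.orthonormal.1 n, inner_self_eq_norm_sq_to_K]
      · intro i hi
        simp [hT, e.orthonormal.2 hi.symm]
    have h4 := h2.unique h3
    rw [e.repr_apply_apply, mul_comm]
    exact h4
  refine LinearPMap.ext (le_antisymm ?_ ?_) ?_
  · intro x _
    have h := lp.memℓp (e.repr (T x))
    exact (congrArg (fun g : ℕ → ℂ => Memℓp g 2) (funext (key x))).mp h
  · exact fun x _ => Submodule.mem_top
  · intro x hx hx'
    apply e.repr.injective
    change e.repr (T x) = e.repr (e.repr.symm _)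
    rw [LinearIsometryEquiv.apply_symm_apply]
    ext n
    exact key x n

end

/-! On each index set `Δ_k` the basis vectors `e a` are mixed by the orthogonal Haar matrix of size
`2 ^ k`; the indices outside all `Δ_k` are left alone. The columns of the resulting block matrix `U`
are an orthonormal basis `g`, and `T (g l)` has coordinates `lam a * U a l`. Counting each `Δ_k`
backwards, hypothesis b) says that `lam` on a Haar row of level `s` is comparable to `α ^ (k - s)`,
up to a factor depending only on `k`. That factor cancels in the quotients `lam a / lam b`, which
are all that matters.

Basis: the `m`-th partial sum operator of `(T (g l))` has the matrix `G a b * (lam a / lam b)`,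
where `G` is the Gram matrix of the rows of `U` truncated to the first `m` columns. By the Schur
test it is enough to bound its row and column sums, that is, the row sums of `|G|` for the geometric
weights `α ^ s` and `α⁻¹ ^ s`. `exists_sum_abs_haarGram_le` does this for every ratio strictly
between `1 / √2` and `√2`, by induction on the size. The condition `1 / √2 < α < 1` puts both `α`
and `α⁻¹` in that range.

Not unconditional: the sum of all columns of a block of size `2 ^ (k + 1)` is a multiple of the
constant row alone, where `lam` is smallest up to a constant. Keeping only every second column
excites each of the `2 ^ k` finest Haar rows, where `lam` is larger by a factor of order `α ^ (-k)`.
So the coordinate projections have norms of order at least `α ^ (-k)`, which is unbounded because `α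
< 1`. -/

open Finset in
theorem sum_range_two_mul (f : ℕ → ℝ) (m : ℕ) :
    ∑ r ∈ range (2 * m), f r = ∑ r ∈ range m, (f (2 * r) + f (2 * r + 1)) := by
  induction m with
  | zero => simp
  | succ m ih =>
    rw [show 2 * (m + 1) = 2 * m + 1 + 1 by ring, sum_range_succ, sum_range_succ, ih,
      sum_range_succ, add_assoc]

/-! ### Haar matrices and the recursion for their truncated Gram matrices. -/

/-- The orthogonal Haar matrix of size `2 ^ k`: row `0` is constant, and row `2 ^ s + p` with
`p < 2 ^ s` is the Haar function on the `p`-th dyadic interval of length `2 ^ (k - s)`. -/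
noncomputable def haar : ℕ → ℕ → ℕ → ℝ
  | 0, _, _ => 1
  | k + 1, q, r =>
    if q < 2 ^ k then (√2)⁻¹ * haar k q (r / 2)
    else if q - 2 ^ k = r / 2 then (-1) ^ r * (√2)⁻¹ else 0

/-- The inner product of two rows of the Haar matrix, truncated to the first `m` columns. -/
noncomputable def haarGram (k m q q' : ℕ) : ℝ :=
  ∑ r ∈ Finset.range m, haar k q r * haar k q' r

theorem inv_sqrt_two_mul_self : (√2)⁻¹ * (√2)⁻¹ = (1 / 2 : ℝ) := by
  rw [← mul_inv, Real.mul_self_sqrt (by norm_num)]; norm_num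

theorem haar_low {k q : ℕ} (hq : q < 2 ^ k) (r : ℕ) :
    haar (k + 1) q r = (√2)⁻¹ * haar k q (r / 2) := by
  simp [haar, hq]

theorem haar_high (k p r : ℕ) :
    haar (k + 1) (2 ^ k + p) r = if p = r / 2 then (-1) ^ r * (√2)⁻¹ else 0 := by
  simp [haar]

theorem haar_high_even (k p r : ℕ) :
    haar (k + 1) (2 ^ k + p) (2 * r) = if p = r then (√2)⁻¹ else 0 := by
  simp [haar_high]

theorem haar_high_odd (k p r : ℕ) :
    haar (k + 1) (2 ^ k + p) (2 * r + 1) = if p = r then -(√2)⁻¹ else 0 := by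
  rw [haar_high, show (2 * r + 1) / 2 = r by omega]
  simp [pow_succ]

theorem haar_low_even {k q : ℕ} (hq : q < 2 ^ k) (r : ℕ) :
    haar (k + 1) q (2 * r) = (√2)⁻¹ * haar k q r := by
  simp [haar_low hq]

theorem haar_low_odd {k q : ℕ} (hq : q < 2 ^ k) (r : ℕ) :
    haar (k + 1) q (2 * r + 1) = (√2)⁻¹ * haar k q r := by
  rw [haar_low hq, show (2 * r + 1) / 2 = r by omega]

theorem haar_zero (k r : ℕ) : haar k 0 r = (√2)⁻¹ ^ k := by
  induction k generalizing r with
  | zero => simp [haar]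
  | succ k ih => rw [haar_low (by positivity), ih, pow_succ, mul_comm]

theorem haarGram_comm (k m q q' : ℕ) : haarGram k m q q' = haarGram k m q' q :=
  Finset.sum_congr rfl fun _ _ => mul_comm _ _

/-- Coarse rows repeat each entry of the smaller matrix twice, scaled by `1 / √2`, so a pair of
columns contributes what one column did before. A truncation at an even column therefore never cuts
a finest Haar function. -/
theorem haarGram_even_low_low {k q q' : ℕ} (hq : q < 2 ^ k) (hq' : q' < 2 ^ k) (m : ℕ) :
    haarGram (k + 1) (2 * m) q q' = haarGram k m q q' := by
  rw [haarGram, sum_range_two_mul]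
  refine Finset.sum_congr rfl fun r _ => ?_
  rw [haar_low_even hq, haar_low_even hq', haar_low_odd hq, haar_low_odd hq']
  linear_combination (2 * haar k q r * haar k q' r) * inv_sqrt_two_mul_self

theorem haarGram_even_low_high {k q : ℕ} (hq : q < 2 ^ k) (m p : ℕ) :
    haarGram (k + 1) (2 * m) q (2 ^ k + p) = 0 := by
  rw [haarGram, sum_range_two_mul]
  refine Finset.sum_eq_zero fun r _ => ?_
  rw [haar_low_even hq, haar_low_odd hq, haar_high_even, haar_high_odd]
  split_ifs <;> ring

theorem haarGram_even_high_high (k m p p' : ℕ) :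
    haarGram (k + 1) (2 * m) (2 ^ k + p) (2 ^ k + p') = if p = p' ∧ p < m then 1 else 0 := by
  rw [haarGram, sum_range_two_mul]
  have : ∀ r ∈ Finset.range m, haar (k + 1) (2 ^ k + p) (2 * r) *
      haar (k + 1) (2 ^ k + p') (2 * r) + haar (k + 1) (2 ^ k + p) (2 * r + 1) *
      haar (k + 1) (2 ^ k + p') (2 * r + 1) = if p = r then (if p' = p then 1 else 0) else 0 := by
    intro r _
    rw [haar_high_even, haar_high_odd, haar_high_even, haar_high_odd]
    have := inv_sqrt_two_mul_self
    split_ifs <;> first | linarith | (exfalso; omega)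
  rw [Finset.sum_congr rfl this, Finset.sum_ite_eq]
  simp only [Finset.mem_range]
  split_ifs <;> first | rfl | (exfalso; omega)

theorem haarGram_odd (k m q q' : ℕ) : haarGram k (2 * m + 1) q q' =
    haarGram k (2 * m) q q' + haar k q (2 * m) * haar k q' (2 * m) :=
  Finset.sum_range_succ _ _

/-! ### Orthogonality of the Haar matrices. -/

/-- The rows of the Haar matrix are orthonormal. -/
theorem haarGram_full (k : ℕ) {q q' : ℕ} (hq : q < 2 ^ k) (hq' : q' < 2 ^ k) :
    haarGram k (2 ^ k) q q' = if q = q' then 1 else 0 := by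
  induction k generalizing q q' with
  | zero =>
    obtain rfl : q = 0 := by simpa using hq
    obtain rfl : q' = 0 := by simpa using hq'
    simp [haarGram, haar]
  | succ k ih =>
    have h2 : 2 ^ (k + 1) = 2 * 2 ^ k := by ring
    rw [h2] at hq hq' ⊢
    rcases lt_or_ge q (2 ^ k) with h | h <;> rcases lt_or_ge q' (2 ^ k) with h' | h'
    · rw [haarGram_even_low_low h h', ih h h']
    · obtain ⟨p', rfl⟩ := Nat.exists_eq_add_of_le h'
      rw [haarGram_even_low_high h, if_neg (by omega)]
    · obtain ⟨p, rfl⟩ := Nat.exists_eq_add_of_le h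
      rw [haarGram_comm, haarGram_even_low_high h', if_neg (by omega)]
    · obtain ⟨p, rfl⟩ := Nat.exists_eq_add_of_le h
      obtain ⟨p', rfl⟩ := Nat.exists_eq_add_of_le h'
      rw [haarGram_even_high_high]
      split_ifs <;> first | rfl | (exfalso; omega)

theorem sum_range_two_pow_succ (k : ℕ) (f : ℕ → ℝ) :
    ∑ q ∈ Finset.range (2 ^ (k + 1)), f q =
      ∑ q ∈ Finset.range (2 ^ k), f q + ∑ p ∈ Finset.range (2 ^ k), f (2 ^ k + p) := by
  rw [pow_succ, mul_two, Finset.sum_range_add]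

/-- The columns of the Haar matrix are orthonormal. -/
theorem haar_column_orthonormal (k : ℕ) {r r' : ℕ} (hr : r < 2 ^ k) (hr' : r' < 2 ^ k) :
    ∑ q ∈ Finset.range (2 ^ k), haar k q r * haar k q r' = if r = r' then 1 else 0 := by
  induction k generalizing r r' with
  | zero =>
    obtain rfl : r = 0 := by simpa using hr
    obtain rfl : r' = 0 := by simpa using hr'
    simp [haar]
  | succ k ih =>
    have h2 : 2 ^ (k + 1) = 2 * 2 ^ k := by ring
    rw [sum_range_two_pow_succ]
    have h1 : ∀ q ∈ Finset.range (2 ^ k), haar (k + 1) q r * haar (k + 1) q r' =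
        (1 / 2) * (haar k q (r / 2) * haar k q (r' / 2)) := by
      intro q hq
      rw [haar_low (Finset.mem_range.1 hq), haar_low (Finset.mem_range.1 hq)]
      linear_combination (haar k q (r / 2) * haar k q (r' / 2)) * inv_sqrt_two_mul_self
    have h3 : ∀ p ∈ Finset.range (2 ^ k), haar (k + 1) (2 ^ k + p) r * haar (k + 1) (2 ^ k + p) r' =
        if r / 2 = p then (if r / 2 = r' / 2 then (1 / 2) * ((-1) ^ r * (-1) ^ r') else 0)
        else 0 := by
      intro p _
      rw [haar_high, haar_high]
      by_cases ha : r / 2 = p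
      · subst ha
        by_cases hb : r / 2 = r' / 2
        · rw [if_pos rfl, if_pos hb, if_pos rfl, if_pos hb]
          linear_combination ((-1) ^ r * (-1) ^ r') * inv_sqrt_two_mul_self
        · simp [hb]
      · rw [if_neg (Ne.symm ha), if_neg ha, zero_mul]
    rw [Finset.sum_congr rfl h1, Finset.sum_congr rfl h3, ← Finset.mul_sum,
      ih (by omega) (by omega), Finset.sum_ite_eq, if_pos (Finset.mem_range.2 (by omega))]
    by_cases hb : r / 2 = r' / 2
    · rw [if_pos hb, if_pos hb]
      obtain ⟨a, rfl | rfl⟩ := Nat.even_or_odd' r <;>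
        obtain ⟨b, rfl | rfl⟩ := Nat.even_or_odd' r' <;>
        simp only [pow_succ, pow_mul] <;>
        split_ifs <;> first | (exfalso; omega) | norm_num
    · rw [if_neg hb, if_neg hb, if_neg (by rintro rfl; exact hb rfl)]; simp

/-! ### Weighted bounds uniform in the size, with `Nat.log 2 q` as the level of row `q`. -/

theorem log_two_pow_add {k p : ℕ} (hp : p < 2 ^ k) : Nat.log 2 (2 ^ k + p) = k :=
  by
  refine Nat.log_eq_of_pow_le_of_lt_pow (by omega) ?_
  rw [pow_succ]; omega

/-- A normalised row of level `s` lives on `2 ^ (k - s)` columns with entries of constant modulus.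
Since `Nat.log 2 0 = 0`, the constant row counts as level `0`, together with row `1`. -/
theorem abs_haar_le (k : ℕ) {q : ℕ} (hq : q < 2 ^ k) (r : ℕ) :
    |haar k q r| ≤ (√2)⁻¹ ^ k * √2 ^ Nat.log 2 q := by
  induction k generalizing q r with
  | zero =>
    obtain rfl : q = 0 := by simpa using hq
    simp [haar]
  | succ k ih =>
    rcases lt_or_ge q (2 ^ k) with h | h
    · rw [haar_low h, abs_mul, abs_of_nonneg (by positivity), pow_succ', mul_assoc]
      exact mul_le_mul_of_nonneg_left (ih h _) (by positivity)
    · obtain ⟨p, rfl⟩ := Nat.exists_eq_add_of_le h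
      rw [log_two_pow_add (by rw [pow_succ] at hq; omega), pow_succ', mul_assoc,
        ← mul_pow, inv_mul_cancel₀ (by positivity), one_pow, mul_one,
        haar_high]
      split_ifs
      · simp [abs_mul, abs_of_nonneg]
      · simp

/-- A column meets one Haar function of each level besides the constant row. The sum is thus
geometric with ratio `√2 * w > 1`, and its finest terms dominate. -/
theorem exists_sum_abs_haar_le {w : ℝ} (hw : (√2)⁻¹ < w) :
    ∃ B : ℝ, 0 ≤ B ∧ ∀ k r : ℕ,
      ∑ q ∈ Finset.range (2 ^ k), |haar k q r| * w ^ Nat.log 2 q ≤ B * w ^ k := by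
  have h0 : (0 : ℝ) < (√2)⁻¹ := by positivity
  have hw0 : 0 < w := h0.trans hw
  have hd : 0 < w - (√2)⁻¹ := sub_pos.2 hw
  -- The induction needs `B * (√2)⁻¹ + (√2)⁻¹ ≤ B * w`; the summand `1` covers size one.
  refine ⟨1 + (√2)⁻¹ / (w - (√2)⁻¹), by positivity, fun k => ?_⟩
  set B := 1 + (√2)⁻¹ / (w - (√2)⁻¹) with hB
  have hB' : B * (√2)⁻¹ + (√2)⁻¹ ≤ B * w := by
    have : B * (w - (√2)⁻¹) = (w - (√2)⁻¹) + (√2)⁻¹ := by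
      rw [hB, add_mul, one_mul, div_mul_cancel₀ _ hd.ne']
    linarith
  induction k with
  | zero =>
    intro r
    have : 0 ≤ (√2)⁻¹ / (w - (√2)⁻¹) := by positivity
    simp [haar, hB, this]
  | succ k ih =>
    intro r
    rw [sum_range_two_pow_succ]
    have h1 : ∀ q ∈ Finset.range (2 ^ k), |haar (k + 1) q r| * w ^ Nat.log 2 q =
        (√2)⁻¹ * (|haar k q (r / 2)| * w ^ Nat.log 2 q) := by
      intro q hq
      rw [haar_low (Finset.mem_range.1 hq), abs_mul, abs_of_pos h0, mul_assoc]
    have h2 : ∀ p ∈ Finset.range (2 ^ k),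
        |haar (k + 1) (2 ^ k + p) r| * w ^ Nat.log 2 (2 ^ k + p) =
        if r / 2 = p then (√2)⁻¹ * w ^ k else 0 := by
      intro p hp
      rw [haar_high, log_two_pow_add (Finset.mem_range.1 hp)]
      by_cases ha : r / 2 = p
      · rw [if_pos ha.symm, if_pos ha, abs_mul, abs_pow]; simp
      · rw [if_neg (Ne.symm ha), if_neg ha]; simp
    rw [Finset.sum_congr rfl h1, Finset.sum_congr rfl h2, ← Finset.mul_sum, Finset.sum_ite_eq]
    have h3 : (if r / 2 ∈ Finset.range (2 ^ k) then (√2)⁻¹ * w ^ k else 0) ≤ (√2)⁻¹ * w ^ k := by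
      split_ifs
      · rfl
      · positivity
    calc _ ≤ (√2)⁻¹ * (B * w ^ k) + (√2)⁻¹ * w ^ k :=
          add_le_add (mul_le_mul_of_nonneg_left (ih _) h0.le) h3
      _ = (B * (√2)⁻¹ + (√2)⁻¹) * w ^ k := by ring
      _ ≤ (B * w) * w ^ k := mul_le_mul_of_nonneg_right hB' (by positivity)
      _ = _ := by ring

/-- The truncated Gram matrices of the Haar matrices satisfy the Schur test, uniformly in the size
and in the truncation, for all geometric weights with ratio between `1 / √2` and `√2`. -/
theorem exists_sum_abs_haarGram_le {w : ℝ} (hw : (√2)⁻¹ < w) (hw' : w < √2) :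
    ∃ C : ℝ, 0 ≤ C ∧ ∀ k m q : ℕ, m ≤ 2 ^ k → q < 2 ^ k →
      ∑ q' ∈ Finset.range (2 ^ k), |haarGram k m q q'| * w ^ Nat.log 2 q' ≤
        C * w ^ Nat.log 2 q := by
  obtain ⟨B, hB0, hB⟩ := exists_sum_abs_haar_le hw
  have h0 : (0 : ℝ) < (√2)⁻¹ := by positivity
  have hw0 : 0 < w := h0.trans hw
  have hhw : (√2)⁻¹ * w < 1 := by
    rw [inv_mul_lt_iff₀ (by positivity)]; simpa using hw'
  have hd : 0 < 1 - (√2)⁻¹ * w := sub_pos.2 hhw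
  -- `C'` is the sum of the geometric series with ratio `w / √2` and first term `1 / 2`. In `C`, the
  -- `1` pays for the diagonal of the finest level, `B / 2` for the coarse entries of a finest row,
  -- and `C'` for all later refinements of a fixed row.
  obtain ⟨C', hC', hC'0⟩ : ∃ C' : ℝ, C' * (1 - (√2)⁻¹ * w) = 1 / 2 ∧ 0 < C' :=
    ⟨1 / 2 / (1 - (√2)⁻¹ * w), div_mul_cancel₀ _ hd.ne', by positivity⟩
  set C := 1 + B / 2 + C' with hC
  -- The bound is strengthened by the part of the geometric series still to come, so that the extra
  -- term of each refinement is absorbed and the constant does not grow with `k`.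
  suffices H : ∀ k m q : ℕ, m ≤ 2 ^ k → q < 2 ^ k →
      ∑ q' ∈ Finset.range (2 ^ k), |haarGram k m q q'| * w ^ Nat.log 2 q' ≤
        C * w ^ Nat.log 2 q - C' * (((√2)⁻¹ * w) ^ k * √2 ^ Nat.log 2 q) by
    refine ⟨C, by positivity, fun k m q hm hq => (H k m q hm hq).trans (sub_le_self _ ?_)⟩
    positivity
  intro k
  induction k with
  | zero =>
    intro m q hm hq
    obtain rfl : q = 0 := by simpa using hq
    have : |haarGram 0 m 0 0| ≤ 1 := by
      have : (m : ℝ) ≤ 1 := by exact_mod_cast (by simpa using hm)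
      simpa [haarGram, haar] using this
    simp only [pow_zero, Finset.range_one, Finset.sum_singleton, Nat.log_zero_right, mul_one]
    linarith
  | succ k ih =>
    intro m q hm hq
    have h2 : 2 ^ (k + 1) = 2 * 2 ^ k := by ring
    rw [sum_range_two_pow_succ]
    rcases lt_or_ge q (2 ^ k) with h | h
    ·
      have hfin : ∀ X Y : ℝ, X ≤ C * w ^ Nat.log 2 q -
          C' * (((√2)⁻¹ * w) ^ k * √2 ^ Nat.log 2 q) →
          Y ≤ 1 / 2 * (((√2)⁻¹ * w) ^ k * √2 ^ Nat.log 2 q) →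
          X + Y ≤ C * w ^ Nat.log 2 q - C' * (((√2)⁻¹ * w) ^ (k + 1) * √2 ^ Nat.log 2 q) := by
        intro X Y hX hY
        refine (add_le_add hX hY).trans_eq ?_
        rw [← hC']; ring
      have hpos : (0 : ℝ) ≤ 1 / 2 * (((√2)⁻¹ * w) ^ k * √2 ^ Nat.log 2 q) := by positivity
      obtain ⟨j, rfl | rfl⟩ := Nat.even_or_odd' m
      · apply hfin
        · refine le_of_eq_of_le (Finset.sum_congr rfl fun q' hq' => ?_) (ih j q (by omega) h)
          rw [haarGram_even_low_low h (Finset.mem_range.1 hq')]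
        · refine le_of_eq_of_le (Finset.sum_eq_zero fun p _ => ?_) hpos
          rw [haarGram_even_low_high h]; simp
      · apply hfin
        -- An odd truncation splits one pair of columns in half, so on coarse rows the Gram matrix
        -- is the average of two consecutive truncations one size below.
        · have hav : ∀ q' ∈ Finset.range (2 ^ k),
              |haarGram (k + 1) (2 * j + 1) q q'| * w ^ Nat.log 2 q' ≤
              1 / 2 * (|haarGram k j q q'| * w ^ Nat.log 2 q') +
              1 / 2 * (|haarGram k (j + 1) q q'| * w ^ Nat.log 2 q') := by
            intro q' hq'
            have : haarGram (k + 1) (2 * j + 1) q q' =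
                1 / 2 * haarGram k j q q' + 1 / 2 * haarGram k (j + 1) q q' := by
              rw [haarGram_odd, haarGram_even_low_low h (Finset.mem_range.1 hq'),
                haar_low_even h, haar_low_even (Finset.mem_range.1 hq'),
                show haarGram k (j + 1) q q' = haarGram k j q q' + haar k q j * haar k q' j from
                  Finset.sum_range_succ _ _]
              linear_combination (haar k q j * haar k q' j) * inv_sqrt_two_mul_self
            rw [this, ← mul_assoc, ← mul_assoc, ← add_mul]
            refine mul_le_mul_of_nonneg_right ((abs_add_le _ _).trans_eq ?_) (by positivity)
            simp [abs_mul]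
          refine (Finset.sum_le_sum hav).trans ?_
          rw [Finset.sum_add_distrib, ← Finset.mul_sum, ← Finset.mul_sum]
          have := ih j q (by omega) h
          have := ih (j + 1) q (by omega) h
          linarith
        -- Only the finest Haar function cut by the truncation correlates with a coarse row.
        · have hsingle : ∀ p ∈ Finset.range (2 ^ k),
              |haarGram (k + 1) (2 * j + 1) q (2 ^ k + p)| * w ^ Nat.log 2 (2 ^ k + p) =
              if p = j then 1 / 2 * |haar k q j| * w ^ k else 0 := by
            intro p hp
            rw [haarGram_odd, haarGram_even_low_high h, haar_low_even h, haar_high_even,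
              log_two_pow_add (Finset.mem_range.1 hp), zero_add]
            split_ifs
            · rw [mul_right_comm, inv_sqrt_two_mul_self, abs_mul]; simp
            · simp
          rw [Finset.sum_congr rfl hsingle, Finset.sum_ite_eq',
            if_pos (Finset.mem_range.2 (by omega)), mul_pow]
          have := mul_le_mul_of_nonneg_right (abs_haar_le k h j) (pow_nonneg hw0.le k)
          linarith
    ·
      obtain ⟨p, rfl⟩ := Nat.exists_eq_add_of_le h
      have hp : p < 2 ^ k := by omega
      have hdiag : ∑ p' ∈ Finset.range (2 ^ k),
          |haarGram (k + 1) m (2 ^ k + p) (2 ^ k + p')| * w ^ Nat.log 2 (2 ^ k + p') ≤ w ^ k := by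
        have hone : ∀ p' ∈ Finset.range (2 ^ k),
            |haarGram (k + 1) m (2 ^ k + p) (2 ^ k + p')| * w ^ Nat.log 2 (2 ^ k + p') ≤
            if p' = p then w ^ k else 0 := by
          intro p' hp'
          rw [log_two_pow_add (Finset.mem_range.1 hp')]
          have : |haarGram (k + 1) m (2 ^ k + p) (2 ^ k + p')| ≤ if p' = p then (1 : ℝ) else 0 := by
            obtain ⟨j, rfl | rfl⟩ := Nat.even_or_odd' m
            · rw [haarGram_even_high_high]
              split_ifs <;> first | (exfalso; omega) | norm_num
            · rw [haarGram_odd, haarGram_even_high_high, haar_high_even, haar_high_even]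
              have := inv_sqrt_two_mul_self
              split_ifs <;> first | (exfalso; omega) | (norm_num [this])
          calc _ ≤ (if p' = p then (1 : ℝ) else 0) * w ^ k :=
                mul_le_mul_of_nonneg_right this (by positivity)
            _ = _ := by split_ifs <;> simp
        refine (Finset.sum_le_sum hone).trans ?_
        rw [Finset.sum_ite_eq', if_pos (Finset.mem_range.2 hp)]
      have hlow : ∑ q' ∈ Finset.range (2 ^ k),
          |haarGram (k + 1) m (2 ^ k + p) q'| * w ^ Nat.log 2 q' ≤ B / 2 * w ^ k := by
        obtain ⟨j, rfl | rfl⟩ := Nat.even_or_odd' m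
        · refine le_of_eq_of_le (Finset.sum_eq_zero fun q' hq' => ?_)
            (by positivity : (0 : ℝ) ≤ B / 2 * w ^ k)
          rw [haarGram_comm, haarGram_even_low_high (Finset.mem_range.1 hq')]; simp
        · have hone : ∀ q' ∈ Finset.range (2 ^ k),
              |haarGram (k + 1) (2 * j + 1) (2 ^ k + p) q'| * w ^ Nat.log 2 q' ≤
              1 / 2 * (|haar k q' j| * w ^ Nat.log 2 q') := by
            intro q' hq'
            rw [haarGram_odd, haarGram_comm, haarGram_even_low_high (Finset.mem_range.1 hq'),
              haar_low_even (Finset.mem_range.1 hq'), haar_high_even, zero_add,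
              ← mul_assoc (1 / 2 : ℝ)]
            refine mul_le_mul_of_nonneg_right ?_ (by positivity)
            split_ifs
            · rw [← mul_assoc, inv_sqrt_two_mul_self, abs_mul]; simp
            · simp
          refine (Finset.sum_le_sum hone).trans ?_
          rw [← Finset.mul_sum]
          have := hB k j
          linarith
      rw [log_two_pow_add hp]
      have e1 : (√2)⁻¹ ^ k * √2 ^ k = 1 := by
        rw [← mul_pow, inv_mul_cancel₀ (by positivity), one_pow]
      have e2 : ((√2)⁻¹ * w) ^ (k + 1) * √2 ^ k ≤ w ^ k := by
        calc ((√2)⁻¹ * w) ^ (k + 1) * √2 ^ k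
            = ((√2)⁻¹ ^ k * √2 ^ k) * ((√2)⁻¹ * w) * w ^ k := by ring
          _ = ((√2)⁻¹ * w) * w ^ k := by rw [e1]; ring
          _ ≤ 1 * w ^ k := mul_le_mul_of_nonneg_right hhw.le (by positivity)
          _ = _ := one_mul _
      have e3 := mul_le_mul_of_nonneg_left e2 hC'0.le
      have : C * w ^ k = w ^ k + B / 2 * w ^ k + C' * w ^ k := by rw [hC]; ring
      linarith

/-! ### The Schur test and Schauder bases in a Hilbert space. -/

section

variable {H : Type*} [NormedAddCommGroup H] [InnerProductSpace ℂ H]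

/-- The Schur test for a matrix with finitely supported rows and columns. -/
theorem sum_norm_sq_sum_mul_le {blk : ℕ → Finset ℕ}
    (hblk : ∀ a b, a ∈ blk b ↔ b ∈ blk a) {K : ℕ → ℕ → ℝ} {C : ℝ} (hC : 0 ≤ C)
    (hrow : ∀ a, ∑ b ∈ blk a, |K a b| ≤ C) (hcol : ∀ b, ∑ a ∈ blk b, |K a b| ≤ C)
    {x : ℕ → ℂ} {M : ℝ} (hx : ∀ t : Finset ℕ, ∑ b ∈ t, ‖x b‖ ^ 2 ≤ M) (s : Finset ℕ) :
    ∑ a ∈ s, ‖∑ b ∈ blk a, (K a b : ℂ) * x b‖ ^ 2 ≤ C ^ 2 * M := by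
  have h1 : ∀ a ∈ s, ‖∑ b ∈ blk a, (K a b : ℂ) * x b‖ ^ 2 ≤
      C * ∑ b ∈ blk a, |K a b| * ‖x b‖ ^ 2 := by
    intro a _
    have hn : ‖∑ b ∈ blk a, (K a b : ℂ) * x b‖ ≤ ∑ b ∈ blk a, |K a b| * ‖x b‖ := by
      refine (norm_sum_le _ _).trans_eq (Finset.sum_congr rfl fun b _ => ?_)
      rw [norm_mul, Complex.norm_real, Real.norm_eq_abs]
    calc _ ≤ (∑ b ∈ blk a, |K a b| * ‖x b‖) ^ 2 := by gcongr
      -- Cauchy–Schwarz with `|K a b|` split evenly between the two factors.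
      _ ≤ (∑ b ∈ blk a, |K a b|) * ∑ b ∈ blk a, |K a b| * ‖x b‖ ^ 2 :=
        Finset.sum_sq_le_sum_mul_sum_of_sq_le_mul _ (fun _ _ => abs_nonneg _)
          (fun _ _ => by positivity) (fun _ _ => le_of_eq (by ring))
      _ ≤ _ := mul_le_mul_of_nonneg_right (hrow a) (by positivity)
  have h2 : ∑ a ∈ s, ∑ b ∈ blk a, |K a b| * ‖x b‖ ^ 2 ≤ C * M := by
    rw [Finset.sum_comm' (s' := fun b => s.filter fun a => b ∈ blk a) (t' := s.biUnion blk)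
      (by simp only [Finset.mem_filter, Finset.mem_biUnion]; grind)]
    calc _ ≤ ∑ b ∈ s.biUnion blk, C * ‖x b‖ ^ 2 := by
          refine Finset.sum_le_sum fun b _ => ?_
          rw [← Finset.sum_mul]
          refine mul_le_mul_of_nonneg_right (le_trans ?_ (hcol b)) (by positivity)
          refine Finset.sum_le_sum_of_subset_of_nonneg (fun a ha => ?_) fun _ _ _ => abs_nonneg _
          exact (hblk a b).2 (Finset.mem_filter.1 ha).2
      _ = C * ∑ b ∈ s.biUnion blk, ‖x b‖ ^ 2 := by rw [Finset.mul_sum]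
      _ ≤ C * M := mul_le_mul_of_nonneg_left (hx _) hC
  calc _ ≤ ∑ a ∈ s, C * ∑ b ∈ blk a, |K a b| * ‖x b‖ ^ 2 := Finset.sum_le_sum h1
    _ = C * ∑ a ∈ s, ∑ b ∈ blk a, |K a b| * ‖x b‖ ^ 2 := by rw [Finset.mul_sum]
    _ ≤ C * (C * M) := mul_le_mul_of_nonneg_left h2 hC
    _ = _ := by ring

theorem sum_norm_repr_sq_le (e : HilbertBasis ℕ ℂ H) (x : H) (t : Finset ℕ) :
    ∑ b ∈ t, ‖e.repr x b‖ ^ 2 ≤ ‖x‖ ^ 2 := by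
  simpa [e.repr_apply_apply] using e.orthonormal.sum_inner_products_le x (s := t)

theorem norm_le_of_sum_norm_repr_sq_le (e : HilbertBasis ℕ ℂ H) {x : H} {C : ℝ} (hC : 0 ≤ C)
    (h : ∀ t : Finset ℕ, ∑ b ∈ t, ‖e.repr x b‖ ^ 2 ≤ C ^ 2) : ‖x‖ ≤ C := by
  rw [← e.repr.norm_map]
  exact lp.norm_le_of_forall_sum_le (by norm_num) hC fun s => by simpa using h s

theorem repr_basis_apply (e : HilbertBasis ℕ ℂ H) (a b : ℕ) :
    e.repr (e a) b = if b = a then 1 else 0 := by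
  rw [e.repr_self]
  simp [lp.single_apply, Pi.single_apply]

theorem repr_sum_smul_apply (e : HilbertBasis ℕ ℂ H) (s : Finset ℕ) (c : ℕ → ℂ) (v : ℕ → H)
    (b : ℕ) : e.repr (∑ a ∈ s, c a • v a) b = ∑ a ∈ s, c a * e.repr (v a) b := by
  simp only [e.repr_apply_apply, inner_sum, inner_smul_right]

theorem repr_sum_smul_basis_apply (e : HilbertBasis ℕ ℂ H) (s : Finset ℕ) (c : ℕ → ℂ)
    (b : ℕ) : e.repr (∑ a ∈ s, c a • e a) b = if b ∈ s then c b else 0 := by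
  rw [repr_sum_smul_apply]
  simp [repr_basis_apply]

theorem HilbertBasis.ext_repr (e : HilbertBasis ℕ ℂ H) {x y : H}
    (h : ∀ a, e.repr x a = e.repr y a) : x = y :=
  e.repr.injective (lp.ext (funext h))

theorem repr_diagonalOperator (e : HilbertBasis ℕ ℂ H) (lam : ℕ → ℂ)
    (x : (diagonalOperator e lam).domain) (a : ℕ) :
    e.repr (diagonalOperator e lam x) a = lam a * e.repr (x : H) a := by
  change e.repr (e.repr.symm _) a = _
  rw [LinearIsometryEquiv.apply_symm_apply]

theorem mem_diagonalOperator_domain_of_finset (e : HilbertBasis ℕ ℂ H) (lam : ℕ → ℂ) {x : H}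
    (s : Finset ℕ) (hx : ∀ a ∉ s, e.repr x a = 0) : x ∈ (diagonalOperator e lam).domain := by
  change Memℓp (fun n => lam n * e.repr x n) 2
  have : (fun n => lam n * e.repr x n) =
      fun n => e.repr (∑ a ∈ s, (lam a * e.repr x a) • e a) n := by
    funext n
    rw [repr_sum_smul_basis_apply]
    split_ifs with h
    · rfl
    · rw [hx n h, mul_zero]
  rw [this]
  exact lp.memℓp _

/-- Uniformly bounded partial sum operators that are eventually the identity on the elements of a
Hilbert basis come from a Schauder basis. -/
theorem isSchauderBasis_of_bounded (e : HilbertBasis ℕ ℂ H) (f : ℕ → H)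
    (φ : ℕ → StrongDual ℂ H) (hφ : ∀ i j, φ i (f j) = if i = j then 1 else 0) {C : ℝ}
    (hC : ∀ m x, ‖∑ l ∈ Finset.range m, φ l x • f l‖ ≤ C * ‖x‖)
    (he : ∀ a, e a ∈ Submodule.span ℂ (Set.range f)) : IsSchauderBasis f := by
  refine ⟨⟨f, φ, fun i j => by simp [hφ, Pi.single_apply], fun x => ?_⟩, rfl⟩
  rw [HasSum, SummationFilter.conditional_filter_eq_map_range, Filter.tendsto_map'_iff]
  change Filter.Tendsto (fun m => ∑ l ∈ Finset.range m, φ l x • f l) _ _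
  have hspan : ∀ y ∈ Submodule.span ℂ (Set.range f),
      ∀ᶠ m in Filter.atTop, ∑ l ∈ Finset.range m, φ l y • f l = y := by
    intro y hy
    induction hy using Submodule.span_induction with
    | mem y hy =>
      obtain ⟨j, rfl⟩ := hy
      filter_upwards [Filter.eventually_gt_atTop j] with m hm
      simp [hφ, hm]
    | zero => simp
    | add y z _ _ hy hz =>
      filter_upwards [hy, hz] with m hy hz
      simp [add_smul, Finset.sum_add_distrib, hy, hz]
    | smul a y _ hy =>
      filter_upwards [hy] with m hy
      simp only [map_smul, smul_assoc, ← Finset.smul_sum, hy]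
  have hdense : x ∈ closure (Submodule.span ℂ (Set.range f) : Set H) := by
    have h1 : x ∈ (Submodule.span ℂ (Set.range e)).topologicalClosure := by
      rw [e.dense_span]; trivial
    refine closure_mono ?_ h1
    exact Submodule.span_le.2 (by rintro _ ⟨a, rfl⟩; exact he a)
  rw [Metric.tendsto_nhds]
  intro ε hε
  obtain ⟨y, hy, hxy⟩ := Metric.mem_closure_iff.1 hdense (ε / (|C| + 1)) (by positivity)
  filter_upwards [hspan y hy] with m hm
  -- The partial sum already fixes `y`, so the error at `x` equals the error at `x - y`.
  have h1 : ∑ l ∈ Finset.range m, φ l x • f l - x =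
      ∑ l ∈ Finset.range m, φ l (x - y) • f l - (x - y) := by
    simp only [map_sub, sub_smul, Finset.sum_sub_distrib, hm]
    abel
  rw [dist_eq_norm] at hxy
  rw [dist_eq_norm, h1]
  calc _ ≤ C * ‖x - y‖ + ‖x - y‖ := (norm_sub_le _ _).trans (add_le_add_left (hC m _) _)
    _ ≤ |C| * ‖x - y‖ + ‖x - y‖ := by gcongr; exact le_abs_self C
    _ = (|C| + 1) * ‖x - y‖ := by ring
    _ < (|C| + 1) * (ε / (|C| + 1)) := by gcongr
    _ = ε := mul_div_cancel₀ _ (by positivity)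

/-- An orthogonal matrix `U` with finite diagonal blocks turns a diagonal operator into a Schauder
operator if its truncated Gram matrices, conjugated by the diagonal, satisfy the Schur test. -/
theorem exists_hilbertBasis_isSchauderBasis [CompleteSpace H] (e : HilbertBasis ℕ ℂ H) {lam : ℕ → ℝ}
    (hlam : ∀ m, 0 < lam m) {blk : ℕ → Finset ℕ} (hself : ∀ a, a ∈ blk a)
    (hblk : ∀ a b, b ∈ blk a → blk b = blk a) {U : ℕ → ℕ → ℝ}
    (hU : ∀ a l, a ∉ blk l → U a l = 0)
    (hcol : ∀ l l', ∑ a ∈ blk l, U a l * U a l' = if l = l' then 1 else 0)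
    (hrow : ∀ a b, ∑ l ∈ blk a, U a l * U b l = if a = b then 1 else 0) {C : ℝ}
    (hC : ∀ m a, ∑ b ∈ blk a,
      |∑ l ∈ Finset.range m, U a l * U b l| * (lam a / lam b) ≤ C)
    (hC' : ∀ m a, ∑ b ∈ blk a,
      |∑ l ∈ Finset.range m, U a l * U b l| * (lam b / lam a) ≤ C) :
    ∃ (g : HilbertBasis ℕ ℂ H)
      (hg : ∀ l, g l ∈ (diagonalOperator e fun m => (lam m : ℂ)).domain),
      (∀ l a, e.repr (g l) a = U a l) ∧
      IsSchauderBasis fun l => diagonalOperator e (fun m => (lam m : ℂ)) ⟨g l, hg l⟩ := by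
  have hsymm : ∀ a b, a ∈ blk b ↔ b ∈ blk a := fun a b =>
    ⟨fun h => by rw [hblk b a h]; exact hself b, fun h => by rw [hblk a b h]; exact hself a⟩
  have hlam0 : ∀ a, (lam a : ℂ) ≠ 0 := fun a => by exact_mod_cast (hlam a).ne'
  have hcolC : ∀ l l', ∑ a ∈ blk l, (U a l : ℂ) * U a l' = if l = l' then 1 else 0 := by
    intro l l'
    have := congrArg (fun z : ℝ => (z : ℂ)) (hcol l l')
    simpa [apply_ite] using this
  have hrowC : ∀ a b, ∑ l ∈ blk a, (U a l : ℂ) * U b l = if a = b then 1 else 0 := by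
    intro a b
    have := congrArg (fun z : ℝ => (z : ℂ)) (hrow a b)
    simpa [apply_ite] using this
  set v : ℕ → H := fun l => ∑ a ∈ blk l, (U a l : ℂ) • e a with hv
  have hvrepr : ∀ l a, e.repr (v l) a = U a l := by
    intro l a
    rw [hv]
    simp only [repr_sum_smul_basis_apply]
    split_ifs with h
    · rfl
    · simp [hU a l h]
  have hvo : Orthonormal ℂ v := by
    rw [orthonormal_iff_ite]
    intro l l'
    rw [← hcolC l l', hv]
    simp only [sum_inner, inner_smul_left, Complex.conj_ofReal]
    refine Finset.sum_congr rfl fun a _ => ?_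
    rw [← hvrepr l' a, e.repr_apply_apply]
  have hev : ∀ a, e a = ∑ l ∈ blk a, (U a l : ℂ) • v l := by
    intro a
    refine e.ext_repr fun b => ?_
    rw [repr_basis_apply, repr_sum_smul_apply]
    simp only [hvrepr, hrowC, eq_comm]
  have hvd : ⊤ ≤ (Submodule.span ℂ (Set.range v)).topologicalClosure := by
    rw [← e.dense_span]
    refine Submodule.topologicalClosure_mono (Submodule.span_le.2 ?_)
    rintro _ ⟨a, rfl⟩
    rw [hev a]
    exact Submodule.sum_mem _ fun l _ => Submodule.smul_mem _ _ (Submodule.subset_span ⟨l, rfl⟩)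
  have hgv : ∀ l, HilbertBasis.mk hvo hvd l = v l := fun l => by rw [HilbertBasis.coe_mk]
  refine ⟨HilbertBasis.mk hvo hvd, fun l => ?_, fun l a => by rw [hgv, hvrepr], ?_⟩
  · refine mem_diagonalOperator_domain_of_finset e _ (blk l) fun a ha => ?_
    rw [hgv, hvrepr, hU a l ha, Complex.ofReal_zero]
  set f : ℕ → H := fun l => diagonalOperator e (fun m => (lam m : ℂ))
    ⟨HilbertBasis.mk hvo hvd l, _⟩ with hf
  have hfrepr : ∀ l a, e.repr (f l) a = lam a * U a l := by
    intro l a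
    rw [hf]
    simp only [repr_diagonalOperator, hgv, hvrepr]
  -- The dual system is formally `T⁻¹ (g l)`; since `U` is real, no conjugates appear.
  set φ : ℕ → StrongDual ℂ H := fun l =>
    ∑ a ∈ blk l, ((lam a : ℂ)⁻¹ * U a l) • innerSL ℂ (e a) with hφ
  have hφx : ∀ l x, φ l x = ∑ a ∈ blk l, ((lam a : ℂ)⁻¹ * U a l) * e.repr x a := by
    intro l x
    simp [hφ, e.repr_apply_apply, sum_apply]
  -- The partial sum operator is the truncated Gram matrix conjugated by the diagonal.
  have hsum : ∀ m x a, e.repr (∑ l ∈ Finset.range m, φ l x • f l) a =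
      ∑ b ∈ blk a, (((∑ l ∈ Finset.range m, U a l * U b l) * (lam a / lam b) : ℝ) : ℂ) *
        e.repr x b := by
    intro m x a
    rw [repr_sum_smul_apply]
    push_cast
    simp only [Finset.sum_mul]
    rw [Finset.sum_comm]
    refine Finset.sum_congr rfl fun l _ => ?_
    by_cases h : a ∈ blk l
    · rw [hφx, hfrepr, hblk l a h, Finset.sum_mul]
      refine Finset.sum_congr rfl fun b _ => ?_
      rw [div_eq_mul_inv]
      ring
    · simp [hfrepr, hU a l h]
  have hC0 : 0 ≤ C := (Finset.sum_nonneg fun b _ => mul_nonneg (abs_nonneg _)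
    (div_pos (hlam 0) (hlam b)).le).trans (hC 0 0)
  refine isSchauderBasis_of_bounded e f φ (fun i j => ?_) (C := C) (fun m x => ?_) fun a => ?_
  · rw [hφx, ← hcolC i j]
    refine Finset.sum_congr rfl fun a _ => ?_
    rw [hfrepr]
    field_simp [hlam0 a]
  · refine norm_le_of_sum_norm_repr_sq_le e (by positivity) fun t => ?_
    rw [mul_pow]
    simp only [hsum]
    have habs : ∀ a b m, |(∑ l ∈ Finset.range m, U a l * U b l) * (lam a / lam b)| =
        |∑ l ∈ Finset.range m, U a l * U b l| * (lam a / lam b) := fun a b m => by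
      rw [abs_mul, abs_of_pos (div_pos (hlam a) (hlam b))]
    refine sum_norm_sq_sum_mul_le (K := fun a b =>
      (∑ l ∈ Finset.range m, U a l * U b l) * (lam a / lam b)) hsymm hC0 (fun a => ?_)
      (fun b => ?_) (sum_norm_repr_sq_le e x) t
    · simp only [habs]
      exact hC m a
    · simp only [habs]
      refine le_of_eq_of_le (Finset.sum_congr rfl fun a _ => ?_) (hC' m b)
      simp only [mul_comm]
  · have : e a = ∑ l ∈ blk a, ((U a l : ℂ) * (lam a : ℂ)⁻¹) • f l := by
      refine e.ext_repr fun b => ?_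
      rw [repr_basis_apply, repr_sum_smul_apply]
      have : ∀ l ∈ blk a, (U a l : ℂ) * (lam a : ℂ)⁻¹ * e.repr (f l) b =
          (lam a : ℂ)⁻¹ * lam b * (U a l * U b l) := by
        intro l _
        rw [hfrepr]; ring
      rw [Finset.sum_congr rfl this, ← Finset.mul_sum, hrowC]
      by_cases h : b = a
      · subst h; simp [hlam0]
      · rw [if_neg h, if_neg (Ne.symm h), mul_zero]
    rw [this]
    exact Submodule.sum_mem _ fun l _ => Submodule.smul_mem _ _ (Submodule.subset_span ⟨l, rfl⟩)

end

/-! ### Block diagonal Haar matrices along a partition of `ℕ`. -/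

/-- A partition of `ℕ` into finite blocks of dyadic size, with an enumeration of each block. -/
structure DyadicBlocks where
  /-- The block of an index. -/
  blk : ℕ → Finset ℕ
  /-- The binary logarithm of the size of the block of an index. -/
  size : ℕ → ℕ
  /-- The position of an index in the enumeration of its block. -/
  row : ℕ → ℕ
  self_mem : ∀ a, a ∈ blk a
  blk_eq : ∀ a b, b ∈ blk a → blk b = blk a
  size_eq : ∀ a b, b ∈ blk a → size b = size a
  row_injOn : ∀ a, Set.InjOn row (blk a)
  image_row : ∀ a, (blk a).image row = Finset.range (2 ^ size a)

theorem sum_range_ite_count (s : Finset ℕ) (F : ℕ → ℝ) (m : ℕ) :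
    ∑ l ∈ Finset.range m, (if l ∈ s then F (Nat.count (· ∈ s) l) else 0) =
      ∑ r ∈ Finset.range (Nat.count (· ∈ s) m), F r := by
  induction m with
  | zero => simp
  | succ m ih =>
    rw [Finset.sum_range_succ, ih, Nat.count_succ]
    split_ifs
    · rw [Finset.sum_range_succ]
    · simp

theorem count_mem_le_card (s : Finset ℕ) (m : ℕ) : Nat.count (· ∈ s) m ≤ s.card := by
  rw [Nat.count_eq_card_filter_range]
  exact Finset.card_le_card fun x hx => (Finset.mem_filter.1 hx).2

theorem sum_mem_eq_sum_range_ite {s : Finset ℕ} {m : ℕ} (hm : s ⊆ Finset.range m) (F : ℕ → ℝ) :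
    ∑ l ∈ s, F l = ∑ l ∈ Finset.range m, if l ∈ s then F l else 0 := by
  rw [← Finset.sum_filter, Finset.filter_mem_eq_inter, Finset.inter_eq_right.2 hm]

theorem count_mem_eq_card {s : Finset ℕ} {m : ℕ} (hm : s ⊆ Finset.range m) :
    Nat.count (· ∈ s) m = s.card := by
  rw [Nat.count_eq_card_filter_range, Finset.filter_mem_eq_inter, Finset.inter_eq_right.2 hm]

theorem sum_count_mem (s : Finset ℕ) (F : ℕ → ℝ) :
    ∑ l ∈ s, F (Nat.count (· ∈ s) l) = ∑ r ∈ Finset.range s.card, F r := by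
  obtain ⟨m, hm⟩ := s.exists_nat_subset_range
  rw [sum_mem_eq_sum_range_ite hm, sum_range_ite_count, count_mem_eq_card hm]

namespace DyadicBlocks

variable (B : DyadicBlocks)

theorem mem_comm (a b : ℕ) : a ∈ B.blk b ↔ b ∈ B.blk a :=
  ⟨fun h => by rw [B.blk_eq b a h]; exact B.self_mem b,
    fun h => by rw [B.blk_eq a b h]; exact B.self_mem a⟩

theorem sum_row (a : ℕ) (F : ℕ → ℝ) :
    ∑ b ∈ B.blk a, F (B.row b) = ∑ q ∈ Finset.range (2 ^ B.size a), F q := by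
  rw [← B.image_row, Finset.sum_image (B.row_injOn a)]

theorem card_blk (a : ℕ) : (B.blk a).card = 2 ^ B.size a := by
  rw [← Finset.card_image_of_injOn (B.row_injOn a), B.image_row, Finset.card_range]

theorem row_lt {a b : ℕ} (h : b ∈ B.blk a) : B.row b < 2 ^ B.size a := by
  rw [← Finset.mem_range, ← B.image_row]
  exact Finset.mem_image_of_mem _ h

/-- The rank of an index in its block, in the natural order. -/
def rank (l : ℕ) : ℕ := Nat.count (· ∈ B.blk l) l

theorem rank_eq {a l : ℕ} (h : l ∈ B.blk a) : B.rank l = Nat.count (· ∈ B.blk a) l := by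
  simp only [rank, B.blk_eq a l h]

theorem rank_lt (l : ℕ) : B.rank l < 2 ^ B.size l := by
  rw [← B.card_blk]
  refine lt_of_lt_of_le ?_ (count_mem_le_card _ (l + 1))
  rw [Nat.count_succ, if_pos (B.self_mem l)]
  exact Nat.lt_succ_self _

theorem rank_inj {l l' : ℕ} (h : l' ∈ B.blk l) (hr : B.rank l = B.rank l') : l = l' := by
  rw [B.rank_eq h] at hr
  exact Nat.count_injective (B.self_mem l) h hr

theorem sum_rank (a : ℕ) (F : ℕ → ℝ) :
    ∑ l ∈ B.blk a, F (B.rank l) = ∑ r ∈ Finset.range (2 ^ B.size a), F r := by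
  rw [← B.card_blk, ← sum_count_mem]
  exact Finset.sum_congr rfl fun l hl => by rw [B.rank_eq hl]

/-- The block diagonal matrix with a Haar matrix in each block: the rows are enumerated by `row`,
the columns in their natural order. -/
noncomputable def matrix (a l : ℕ) : ℝ :=
  if a ∈ B.blk l then haar (B.size l) (B.row a) (B.rank l) else 0

theorem matrix_of_mem {a l : ℕ} (h : l ∈ B.blk a) :
    B.matrix a l = haar (B.size a) (B.row a) (B.rank l) := by
  rw [matrix, if_pos ((B.mem_comm _ _).1 h), B.size_eq a l h]

theorem matrix_of_notMem {a l : ℕ} (h : l ∉ B.blk a) : B.matrix a l = 0 := by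
  rw [matrix, if_neg (mt (B.mem_comm _ _).1 h)]

/-- Columns are placed by rank in the natural order, so the first `m` columns meet each block in an
initial segment, however the blocks interleave. Global truncations thus reduce to truncations of a
single Haar matrix. -/
theorem sum_matrix_mul_matrix_range (m : ℕ) {a b : ℕ} (hb : b ∈ B.blk a) :
    ∑ l ∈ Finset.range m, B.matrix a l * B.matrix b l =
      haarGram (B.size a) (Nat.count (· ∈ B.blk a) m) (B.row a) (B.row b) := by
  rw [haarGram, ← sum_range_ite_count]
  refine Finset.sum_congr rfl fun l _ => ?_
  split_ifs with h
  · rw [B.matrix_of_mem h, B.matrix_of_mem (by rwa [B.blk_eq a b hb]), B.size_eq a b hb,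
      B.rank_eq h]
  · rw [B.matrix_of_notMem h, zero_mul]

theorem sum_matrix_row (a b : ℕ) :
    ∑ l ∈ B.blk a, B.matrix a l * B.matrix b l = if a = b then 1 else 0 := by
  by_cases hb : b ∈ B.blk a
  · have h1 : ∀ l ∈ B.blk a, B.matrix a l * B.matrix b l =
        haar (B.size a) (B.row a) (B.rank l) * haar (B.size a) (B.row b) (B.rank l) := by
      intro l h
      rw [B.matrix_of_mem h, B.matrix_of_mem (by rwa [B.blk_eq a b hb]), B.size_eq a b hb]
    rw [Finset.sum_congr rfl h1, B.sum_rank a fun r => haar (B.size a) (B.row a) r *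
      haar (B.size a) (B.row b) r]
    refine (haarGram_full _ (B.row_lt (B.self_mem a)) (B.row_lt hb)).trans ?_
    exact if_congr ⟨fun h => B.row_injOn a (B.self_mem a) hb h, fun h => by rw [h]⟩ rfl rfl
  · rw [if_neg (by rintro rfl; exact hb (B.self_mem _))]
    refine Finset.sum_eq_zero fun l hl => ?_
    rw [B.matrix_of_notMem (a := b), mul_zero]
    intro h
    exact hb (by rw [← B.blk_eq a l hl]; exact (B.mem_comm _ _).1 h)

theorem sum_matrix_column (l l' : ℕ) :
    ∑ a ∈ B.blk l, B.matrix a l * B.matrix a l' = if l = l' then 1 else 0 := by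
  by_cases hb : l' ∈ B.blk l
  · have h1 : ∀ a ∈ B.blk l, B.matrix a l * B.matrix a l' =
        haar (B.size l) (B.row a) (B.rank l) * haar (B.size l) (B.row a) (B.rank l') := by
      intro a h
      rw [B.matrix_of_mem ((B.mem_comm _ _).1 h), B.matrix_of_mem (by rwa [B.blk_eq l a h]),
        B.size_eq l a h]
    rw [Finset.sum_congr rfl h1, B.sum_row l fun q => haar (B.size l) q (B.rank l) *
      haar (B.size l) q (B.rank l'), haar_column_orthonormal _ (B.rank_lt l)
        (by rw [← B.size_eq l l' hb]; exact B.rank_lt l')]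
    exact if_congr ⟨fun h => B.rank_inj hb h, fun h => by rw [h]⟩ rfl rfl
  · rw [if_neg (by rintro rfl; exact hb (B.self_mem _))]
    refine Finset.sum_eq_zero fun a ha => ?_
    rw [B.matrix_of_notMem (l := l'), mul_zero]
    rwa [B.blk_eq l a ha]

variable {H : Type*} [NormedAddCommGroup H] [InnerProductSpace ℂ H]

/-- Transfers the Haar estimate to one block. It serves both halves of the Schur test, with the
weight `α` and with its inverse. -/
theorem sum_abs_gram_mul_le {α C D : ℝ} (hα : 0 < α) (hD : 0 ≤ D)
    (hC : ∀ k m q : ℕ, m ≤ 2 ^ k → q < 2 ^ k →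
      ∑ q' ∈ Finset.range (2 ^ k), |haarGram k m q q'| * α ^ Nat.log 2 q' ≤ C * α ^ Nat.log 2 q)
    {ρ : ℕ → ℕ → ℝ} (hρ : ∀ a, ∀ b ∈ B.blk a,
      ρ a b ≤ D * (α ^ Nat.log 2 (B.row b) / α ^ Nat.log 2 (B.row a))) (m a : ℕ) :
    ∑ b ∈ B.blk a, |∑ l ∈ Finset.range m, B.matrix a l * B.matrix b l| * ρ a b ≤ D * C := by
  set n := Nat.count (· ∈ B.blk a) m
  have h1 : ∀ b ∈ B.blk a, |∑ l ∈ Finset.range m, B.matrix a l * B.matrix b l| * ρ a b ≤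
      D / α ^ Nat.log 2 (B.row a) * (|haarGram (B.size a) n (B.row a) (B.row b)| *
        α ^ Nat.log 2 (B.row b)) := by
    intro b hb
    rw [B.sum_matrix_mul_matrix_range m hb]
    refine (mul_le_mul_of_nonneg_left (hρ a b hb) (abs_nonneg _)).trans_eq ?_
    ring
  refine (Finset.sum_le_sum h1).trans ?_
  rw [← Finset.mul_sum, B.sum_row a fun q => |haarGram (B.size a) n (B.row a) q| * α ^ Nat.log 2 q]
  calc _ ≤ D / α ^ Nat.log 2 (B.row a) * (C * α ^ Nat.log 2 (B.row a)) := by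
        refine mul_le_mul_of_nonneg_left (hC _ _ _ ?_ (B.row_lt (B.self_mem a))) (by positivity)
        exact (count_mem_le_card _ _).trans_eq (B.card_blk a)
    _ = D * C := by field_simp

theorem exists_isSchauderBasis [CompleteSpace H] (e : HilbertBasis ℕ ℂ H) {lam : ℕ → ℝ}
    (hlam : ∀ m, 0 < lam m) {α D : ℝ} (hα : (√2)⁻¹ < α) (hα' : α < 1) (hD : 0 ≤ D)
    (hw : ∀ a, ∀ b ∈ B.blk a,
      lam a / lam b ≤ D * (α ^ Nat.log 2 (B.row b) / α ^ Nat.log 2 (B.row a))) :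
    ∃ (g : HilbertBasis ℕ ℂ H)
      (hg : ∀ l, g l ∈ (diagonalOperator e fun m => (lam m : ℂ)).domain),
      (∀ l a, e.repr (g l) a = B.matrix a l) ∧
      IsSchauderBasis fun l => diagonalOperator e (fun m => (lam m : ℂ)) ⟨g l, hg l⟩ := by
  have hs : (0 : ℝ) < √2 := by positivity
  have hs1 : 1 < √2 := Real.one_lt_sqrt_two
  have hα0 : 0 < α := (inv_pos.2 hs).trans hα
  obtain ⟨C₁, -, hC₁⟩ := exists_sum_abs_haarGram_le hα (hα'.trans hs1)
  obtain ⟨C₂, -, hC₂⟩ := exists_sum_abs_haarGram_le (w := α⁻¹)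
    ((inv_lt_one_of_one_lt₀ hs1).trans ((one_lt_inv₀ hα0).2 hα'))
    (by simpa using inv_strictAnti₀ (inv_pos.2 hs) hα)
  refine exists_hilbertBasis_isSchauderBasis e hlam B.self_mem B.blk_eq
    (fun a l h => B.matrix_of_notMem (mt (B.mem_comm _ _).1 h)) B.sum_matrix_column
    B.sum_matrix_row (C := max (D * C₁) (D * C₂)) (fun m a => ?_) fun m a => ?_
  · exact (B.sum_abs_gram_mul_le hα0 hD hC₁ hw m a).trans (le_max_left _ _)
  · refine (B.sum_abs_gram_mul_le (inv_pos.2 hα0) hD hC₂ (ρ := fun a b => lam b / lam a)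
      (fun a b hb => ?_) m a).trans (le_max_right _ _)
    refine (hw b a ((B.mem_comm _ _).1 hb)).trans_eq ?_
    rw [inv_pow, inv_pow]
    field_simp

/-! ### Failure of unconditionality. -/

theorem sum_matrix_eq {a b : ℕ} (hb : b ∈ B.blk a) :
    ∑ l ∈ B.blk a, B.matrix b l = if B.row b = 0 then √2 ^ B.size a else 0 := by
  have h1 : ∀ l ∈ B.blk a, B.matrix b l = √2 ^ B.size a *
      (haar (B.size a) (B.row b) (B.rank l) * haar (B.size a) 0 (B.rank l)) := by
    intro l hl
    rw [B.matrix_of_mem (by rwa [B.blk_eq a b hb]), B.size_eq a b hb, haar_zero, mul_left_comm,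
      ← mul_pow, mul_inv_cancel₀ (by positivity), one_pow, mul_one]
  rw [Finset.sum_congr rfl h1, ← Finset.mul_sum, B.sum_rank a fun r =>
    haar (B.size a) (B.row b) r * haar (B.size a) 0 r]
  have := haarGram_full (B.size a) (B.row_lt hb) (q' := 0) (by positivity)
  rw [haarGram] at this
  rw [this]
  split_ifs <;> simp

/-- A finest Haar function has one positive entry, at an even column, and its negative at the next
column; dropping odd ranks removes the cancellation. -/
theorem sum_matrix_even {a b k p : ℕ} (hk : B.size a = k + 1) (hb : b ∈ B.blk a)
    (hp : B.row b = 2 ^ k + p) :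
    ∑ l ∈ B.blk a with Even (B.rank l), B.matrix b l = (√2)⁻¹ := by
  have hlt : p < 2 ^ k := by
    have := B.row_lt hb
    rw [hk, hp, pow_succ] at this
    omega
  have h1 : ∀ l ∈ B.blk a, (if Even (B.rank l) then B.matrix b l else 0) =
      if Even (B.rank l) then haar (k + 1) (2 ^ k + p) (B.rank l) else 0 := by
    intro l hl
    rw [B.matrix_of_mem (by rwa [B.blk_eq a b hb]), B.size_eq a b hb, hk, hp]
  rw [Finset.sum_filter, Finset.sum_congr rfl h1, B.sum_rank a fun r =>
    if Even r then haar (k + 1) (2 ^ k + p) r else 0, hk, pow_succ', sum_range_two_mul]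
  simp [haar_high_even, hlt]

theorem norm_sum_block_eq (e : HilbertBasis ℕ ℂ H) {lam : ℕ → ℝ} (hlam : ∀ m, 0 < lam m)
    {f : ℕ → H} (hf : ∀ l a, e.repr (f l) a = lam a * B.matrix a l) {a : ℕ}
    (ha : B.row a = 0) : ‖∑ l ∈ B.blk a, f l‖ = lam a * √2 ^ B.size a := by
  have : ∑ l ∈ B.blk a, f l = ((lam a * √2 ^ B.size a : ℝ) : ℂ) • e a := by
    refine e.ext_repr fun b => ?_
    have h1 := repr_sum_smul_apply e (B.blk a) 1 f b
    simp only [Pi.one_apply, one_smul, one_mul, hf] at h1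
    have h2 : e.repr (((lam a * √2 ^ B.size a : ℝ) : ℂ) • e a) b =
        ((lam a * √2 ^ B.size a : ℝ) : ℂ) * if b = a then 1 else 0 := by
      rw [map_smul, lp.coeFn_smul, Pi.smul_apply, repr_basis_apply, smul_eq_mul]
    rw [h1, h2, ← Finset.mul_sum, ← Complex.ofReal_sum]
    by_cases hb : b ∈ B.blk a
    · rw [B.sum_matrix_eq hb]
      by_cases hba : b = a
      · subst hba; simp [ha]
      · rw [if_neg fun h => hba (B.row_injOn a hb (B.self_mem a) (h.trans ha.symm)), if_neg hba]
        simp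
    · rw [if_neg (by rintro rfl; exact hb (B.self_mem _)), Finset.sum_eq_zero]
      · simp
      · intro l hl
        refine B.matrix_of_notMem fun h => hb ?_
        rw [← B.blk_eq a l hl]
        exact (B.mem_comm _ _).1 h
  rw [this, norm_smul, e.orthonormal.1, mul_one, Complex.norm_real, Real.norm_eq_abs, abs_of_pos]
  have := hlam a
  positivity

theorem le_norm_sq_sum_even (e : HilbertBasis ℕ ℂ H) {lam : ℕ → ℝ} {f : ℕ → H}
    (hf : ∀ l a, e.repr (f l) a = lam a * B.matrix a l) {a k : ℕ} (hk : B.size a = k + 1) {μ : ℝ}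
    (hμ0 : 0 ≤ μ) (hμ : ∀ b ∈ B.blk a, 2 ^ k ≤ B.row b → μ ≤ lam b) :
    2 ^ k * (μ ^ 2 / 2) ≤ ‖∑ l ∈ B.blk a with Even (B.rank l), f l‖ ^ 2 := by
  refine le_trans ?_ (sum_norm_repr_sq_le e _ {b ∈ B.blk a | 2 ^ k ≤ B.row b})
  have h1 : ∀ b ∈ ({b ∈ B.blk a | 2 ^ k ≤ B.row b} : Finset ℕ), μ ^ 2 / 2 ≤
      ‖e.repr (∑ l ∈ B.blk a with Even (B.rank l), f l) b‖ ^ 2 := by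
    intro b hb
    obtain ⟨hb, hbk⟩ := Finset.mem_filter.1 hb
    obtain ⟨p, hp⟩ := Nat.exists_eq_add_of_le hbk
    have h2 := repr_sum_smul_apply e ({l ∈ B.blk a | Even (B.rank l)} : Finset ℕ) 1 f b
    simp only [Pi.one_apply, one_smul, one_mul, hf] at h2
    rw [h2, ← Finset.mul_sum, ← Complex.ofReal_sum, B.sum_matrix_even hk hb hp,
      ← Complex.ofReal_mul, Complex.norm_real, Real.norm_eq_abs, sq_abs, mul_pow, inv_pow,
      Real.sq_sqrt (by norm_num), ← div_eq_mul_inv]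
    have := hμ b hb hbk
    gcongr
  refine le_trans (le_of_eq ?_) (Finset.sum_le_sum h1)
  have h3 : ∑ b ∈ B.blk a, (if 2 ^ k ≤ B.row b then (1 : ℝ) else 0) = 2 ^ k := by
    rw [B.sum_row a fun q => if 2 ^ k ≤ q then (1 : ℝ) else 0, hk, sum_range_two_pow_succ,
      Finset.sum_eq_zero fun q hq => if_neg (not_le.2 (Finset.mem_range.1 hq))]
    simp
  rw [Finset.sum_const, nsmul_eq_mul, ← h3, Finset.sum_boole]

theorem not_isUnconditionalBasis [CompleteSpace H] (e : HilbertBasis ℕ ℂ H) {lam : ℕ → ℝ}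
    (hlam : ∀ m, 0 < lam m) {α D : ℝ} (hα : 0 < α) (hα' : α < 1) (hD : 0 < D)
    (hw : ∀ a, ∀ b ∈ B.blk a,
      lam a / lam b ≤ D * (α ^ Nat.log 2 (B.row b) / α ^ Nat.log 2 (B.row a)))
    (hsize : ∀ k, ∃ a, B.size a = k + 1)
    {f : ℕ → H} (hf : ∀ l a, e.repr (f l) a = lam a * B.matrix a l) :
    ¬ IsUnconditionalBasis f := by
  rintro ⟨b, rfl⟩
  obtain ⟨C, hC⟩ := UnconditionalSchauderBasis.exists_norm_proj_le b
  have key : ∀ k : ℕ, 1 ≤ 4 * C ^ 2 * D ^ 2 * (α ^ 2) ^ k := by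
    intro k
    obtain ⟨a', ha'⟩ := hsize k
    obtain ⟨a, ha, hrow⟩ : ∃ a ∈ B.blk a', B.row a = 0 := by
      have : 0 ∈ (B.blk a').image B.row := by rw [B.image_row]; simp
      simpa using this
    have hk : B.size a = k + 1 := by rw [B.size_eq a' a ha, ha']
    have hla := hlam a
    -- The finest rows have level `k` and row `0` has level `0`, so the weight comparison gives this
    -- lower bound for `lam` there.
    have hlow := B.le_norm_sq_sum_even e hf hk (μ := lam a / (D * α ^ k)) (by positivity) (by
      intro c hc hck
      have h1 := hw a c hc
      have hlog : Nat.log 2 (B.row c) = k := by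
        refine Nat.log_eq_of_pow_le_of_lt_pow hck ?_
        rw [← hk]; exact B.row_lt hc
      rw [hrow, hlog, Nat.log_zero_right, pow_zero, div_one, div_le_iff₀ (hlam c)] at h1
      rw [div_le_iff₀ (by positivity)]
      linarith)
    have hproj : GeneralSchauderBasis.proj b {l ∈ B.blk a | Even (B.rank l)}
        (∑ l ∈ B.blk a, b.basis l) = ∑ l ∈ B.blk a with Even (B.rank l), b.basis l := by
      rw [map_sum]
      simp only [GeneralSchauderBasis.proj_apply_basis_mem]
      rw [Finset.sum_filter]
      refine Finset.sum_congr rfl fun l hl => ?_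
      simp [hl]
    have hup : ‖∑ l ∈ B.blk a with Even (B.rank l), b.basis l‖ ≤ C * (lam a * √2 ^ (k + 1)) := by
      rw [← hproj, ← hk, ← B.norm_sum_block_eq e hlam hf hrow]
      exact ContinuousLinearMap.le_of_opNorm_le _ (hC _) _
    have h2 : 2 ^ k * ((lam a / (D * α ^ k)) ^ 2 / 2) ≤ (C * (lam a * √2 ^ (k + 1))) ^ 2 :=
      hlow.trans (by gcongr)
    have h3 : (C * (lam a * √2 ^ (k + 1))) ^ 2 = 2 * C ^ 2 * lam a ^ 2 * 2 ^ k := by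
      rw [mul_pow, mul_pow, ← pow_mul, mul_comm (k + 1) 2, pow_mul, Real.sq_sqrt (by norm_num)]
      ring
    have h4 : 2 ^ k * ((lam a / (D * α ^ k)) ^ 2 / 2) =
        (lam a ^ 2 * 2 ^ k / 2) / (D ^ 2 * (α ^ 2) ^ k) := by
      rw [div_pow, mul_pow, ← pow_mul, ← pow_mul, mul_comm k 2]
      field_simp
    rw [h3, h4, div_le_iff₀ (by positivity)] at h2
    have h5 : 0 < lam a ^ 2 * 2 ^ k / 2 := by positivity
    refine le_of_mul_le_mul_left ?_ h5
    linarith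
  have hlim : Filter.Tendsto (fun k : ℕ => 4 * C ^ 2 * D ^ 2 * (α ^ 2) ^ k) Filter.atTop
      (nhds (4 * C ^ 2 * D ^ 2 * 0)) :=
    (tendsto_pow_atTop_nhds_zero_of_lt_one (by positivity)
      (pow_lt_one₀ hα.le hα' two_ne_zero)).const_mul _
  have := ge_of_tendsto' hlim key
  norm_num at this

theorem isConditionalOperator [CompleteSpace H] (e : HilbertBasis ℕ ℂ H) {lam : ℕ → ℝ}
    (hlam : ∀ m, 0 < lam m) {α D : ℝ} (hα : (√2)⁻¹ < α) (hα' : α < 1) (hD : 0 < D)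
    (hw : ∀ a, ∀ b ∈ B.blk a,
      lam a / lam b ≤ D * (α ^ Nat.log 2 (B.row b) / α ^ Nat.log 2 (B.row a)))
    (hsize : ∀ k, ∃ a, B.size a = k + 1) :
    IsConditionalOperator (diagonalOperator e fun m => (lam m : ℂ)) := by
  obtain ⟨g, hg, hrepr, hbasis⟩ := B.exists_isSchauderBasis e hlam hα hα' hD.le hw
  refine ⟨⟨g, hg, hbasis⟩, g, hg, hbasis,
    B.not_isUnconditionalBasis e hlam ((by positivity : (0 : ℝ) < (√2)⁻¹).trans hα) hα' hD hw
      hsize fun l a => ?_⟩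
  rw [repr_diagonalOperator, hrepr]

end DyadicBlocks

/-! ### From the index sets `Δ_k` to dyadic blocks. -/

/-- Finite sets of dyadic sizes that are pairwise disjoint, each with an enumeration, extend to a
partition of `ℕ` into blocks, by singletons. -/
theorem exists_dyadicBlocks (Δ : ℕ → Finset ℕ) (ι : ℕ → ℕ → ℕ)
    (hinj : ∀ k, 1 ≤ k → Set.InjOn (ι k) (Finset.range (2 ^ k)))
    (himage : ∀ k, 1 ≤ k → (Finset.range (2 ^ k)).image (ι k) = Δ k)
    (hdisj : ∀ k k' a, 1 ≤ k → 1 ≤ k' → a ∈ Δ k → a ∈ Δ k' → k = k') :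
    ∃ B : DyadicBlocks, (∀ a, 1 ≤ B.size a → B.blk a = Δ (B.size a) ∧
      ∀ b ∈ B.blk a, B.row b < 2 ^ B.size a ∧ ι (B.size a) (B.row b) = b) ∧
      (∀ a, B.size a = 0 → B.blk a = {a}) ∧ ∀ k, ∃ a, B.size a = k + 1 := by
  classical
  -- Size `0` marks the indices outside every `Δ k`; as `2 ^ 0 = 1`, they form singleton blocks with
  -- row `0`.
  set size : ℕ → ℕ := fun a => if h : ∃ k, 1 ≤ k ∧ a ∈ Δ k then h.choose else 0
  have hsize : ∀ k a, 1 ≤ k → a ∈ Δ k → size a = k := by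
    intro k a hk ha
    have h : ∃ k, 1 ≤ k ∧ a ∈ Δ k := ⟨k, hk, ha⟩
    simp only [size, dif_pos h]
    exact hdisj _ _ a h.choose_spec.1 hk h.choose_spec.2 ha
  have hmem : ∀ a, 1 ≤ size a → a ∈ Δ (size a) := by
    intro a ha
    by_cases h : ∃ k, 1 ≤ k ∧ a ∈ Δ k
    · simp only [size, dif_pos h]; exact h.choose_spec.2
    · simp [size, dif_neg h] at ha
  set row : ℕ → ℕ := fun a =>
    if size a = 0 then 0 else Function.invFunOn (ι (size a)) (Finset.range (2 ^ size a)) a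
  set blk : ℕ → Finset ℕ := fun a => if size a = 0 then {a} else Δ (size a)
  have hblk0 : ∀ a, size a = 0 → blk a = {a} := fun a h => if_pos h
  have hblk1 : ∀ a, 1 ≤ size a → blk a = Δ (size a) := fun a h => if_neg (by omega)
  have hsize_eq : ∀ a b, b ∈ blk a → size b = size a := by
    intro a b hb
    rcases Nat.eq_zero_or_pos (size a) with h | h
    · rw [hblk0 a h, Finset.mem_singleton] at hb
      rw [hb]
    · rw [hblk1 a h] at hb
      exact hsize _ _ h hb
  have hrow : ∀ a, 1 ≤ size a → ∀ b ∈ blk a, row b < 2 ^ size a ∧ ι (size a) (row b) = b := by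
    intro a ha b hb
    have hs := hsize_eq a b hb
    rw [hblk1 a ha, ← himage _ ha] at hb
    have hb' : b ∈ ι (size b) '' (Finset.range (2 ^ size b)) := by
      rw [hs]; simpa using hb
    have : row b = Function.invFunOn (ι (size b)) (Finset.range (2 ^ size b)) b :=
      if_neg (by omega)
    rw [this, ← hs]
    exact ⟨by simpa using Function.invFunOn_mem hb', Function.invFunOn_eq hb'⟩
  have hrow' : ∀ k q, 1 ≤ k → q < 2 ^ k → ι k q ∈ Δ k ∧ row (ι k q) = q := by
    intro k q hk hq
    have h1 : ι k q ∈ Δ k := by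
      rw [← himage k hk]; exact Finset.mem_image_of_mem _ (Finset.mem_range.2 hq)
    have h2 := hsize k _ hk h1
    have h3 := hrow (ι k q) (by omega) (ι k q) (by rw [hblk1 _ (by omega), h2]; exact h1)
    rw [h2] at h3
    exact ⟨h1, hinj k hk (by simpa using h3.1) (by simpa using hq) h3.2⟩
  refine ⟨⟨blk, size, row, fun a => ?_, fun a b hb => ?_, hsize_eq, fun a => ?_, fun a => ?_⟩,
    fun a ha => ⟨hblk1 a ha, hrow a ha⟩, hblk0, fun k => ⟨ι (k + 1) 0, ?_⟩⟩
  · rcases Nat.eq_zero_or_pos (size a) with h | h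
    · rw [hblk0 a h]; exact Finset.mem_singleton_self a
    · rw [hblk1 a h]; exact hmem a h
  · have hs := hsize_eq a b hb
    rcases Nat.eq_zero_or_pos (size a) with h | h
    · rw [hblk0 a h, Finset.mem_singleton] at hb
      rw [hb]
    · rw [hblk1 a h, hblk1 b (by omega), hs]
  · rcases Nat.eq_zero_or_pos (size a) with h | h
    · rw [hblk0 a h]; simp
    · intro b hb c hc hbc
      rw [← (hrow a h b hb).2, ← (hrow a h c hc).2, hbc]
  · rcases Nat.eq_zero_or_pos (size a) with h | h
    · rw [hblk0 a h, h]; simp [row, h]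
    · ext q
      simp only [Finset.mem_image, Finset.mem_range]
      constructor
      · rintro ⟨b, hb, rfl⟩
        exact (hrow a h b hb).1
      · intro hq
        obtain ⟨h1, h2⟩ := hrow' _ q h hq
        exact ⟨_, by rwa [hblk1 a h], h2⟩
  · exact hsize _ _ (by omega) (hrow' (k + 1) 0 (by omega) (by positivity)).1

/-- The weights of the `k`-th index set, in terms of the levels of the Haar functions. -/
theorem pow_div_mem_Icc_of_lt {lam : ℕ → ℝ} {α : ℝ} {c d : ℕ → ℝ} {n : ℕ → ℕ → ℕ}
    (hlast : ∀ k, 1 ≤ k →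
      α ^ k / lam (n k (2 ^ k - 1)) ∈ Set.Icc (c k) (d k) ∧
      α ^ k / lam (n k (2 ^ k)) ∈ Set.Icc (c k) (d k))
    (hblock : ∀ k j i : ℕ, 1 ≤ j → j + 1 ≤ k →
      (2 : ℝ) ^ k * (1 - 1 / 2 ^ (j - 1)) + 1 ≤ i → (i : ℝ) ≤ 2 ^ k * (1 - 1 / 2 ^ j) →
      α ^ j / lam (n k i) ∈ Set.Icc (c k) (d k))
    {k q : ℕ} (hk : 1 ≤ k) (hq : q < 2 ^ k) :
    α ^ (k - Nat.log 2 q) / lam (n k (2 ^ k - q)) ∈ Set.Icc (c k) (d k) := by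
  rcases lt_or_ge q 2 with h2 | h2
  -- Rows `0` and `1` are the last two indices of the set; both have level `0` and hence exponent
  -- `k`.
  · interval_cases q
    · simpa using (hlast k hk).2
    · simpa using (hlast k hk).1
  · have hs1 : 1 ≤ Nat.log 2 q := Nat.log_pos (by norm_num) h2
    have hsk : Nat.log 2 q < k := Nat.log_lt_of_lt_pow (by omega) hq
    have hle : 2 ^ Nat.log 2 q ≤ q := Nat.pow_log_le_self 2 (by omega)
    have hlt : q < 2 ^ (Nat.log 2 q + 1) := Nat.lt_pow_succ_log_self (by norm_num) q
    set s := Nat.log 2 q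
    have hcast : ((2 ^ k - q : ℕ) : ℝ) = 2 ^ k - q := by
      rw [Nat.cast_sub hq.le]; push_cast; rfl
    have hpow : ∀ t u : ℕ, t + u = k → (2 : ℝ) ^ k * (1 - 1 / 2 ^ t) = 2 ^ k - 2 ^ u := by
      rintro t u rfl
      rw [pow_add]
      field_simp
    -- With `i = 2 ^ k - q` and `j = k - s`, the range of `i` in hypothesis b) is exactly `2 ^ s ≤ q
    -- < 2 ^ (s + 1)`.
    refine hblock k (k - s) _ (by omega) (by omega) ?_ ?_
    · rw [hpow _ (s + 1) (by omega), hcast]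
      have : (q : ℝ) + 1 ≤ 2 ^ (s + 1) := by exact_mod_cast hlt
      linarith
    · rw [hpow _ s (by omega), hcast]
      have : (2 : ℝ) ^ s ≤ q := by exact_mod_cast hle
      linarith

/-- Index sets: `n k i`, for `1 ≤ i ≤ 2 ^ k`, enumerates the `k`-th set. -/
theorem mainTheorem4 {H : Type*} [NormedAddCommGroup H] [InnerProductSpace ℂ H] [CompleteSpace H]
    (e : HilbertBasis ℕ ℂ H) (lam : ℕ → ℝ) (hlam : ∀ m, 0 < lam m)
    (α : ℝ) (hα : 1 / Real.sqrt 2 < α) (hα' : α < 1)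
    (c d : ℕ → ℝ) (n : ℕ → ℕ → ℕ)
    (hc : ∀ k, 1 ≤ k → 0 < c k) (hcd : ∀ k, 1 ≤ k → c k ≤ d k)
    (hsup : BddAbove ((fun k => d k / c k) '' Set.Ici 1))
    (hinj : ∀ k, 1 ≤ k → Set.InjOn (n k) (Set.Icc 1 (2 ^ k)))
    (hlast : ∀ k, 1 ≤ k →
      α ^ k / lam (n k (2 ^ k - 1)) ∈ Set.Icc (c k) (d k) ∧
      α ^ k / lam (n k (2 ^ k)) ∈ Set.Icc (c k) (d k))
    (hblock : ∀ k j i : ℕ, 1 ≤ j → j + 1 ≤ k →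
      (2 : ℝ) ^ k * (1 - 1 / 2 ^ (j - 1)) + 1 ≤ i → (i : ℝ) ≤ 2 ^ k * (1 - 1 / 2 ^ j) →
      α ^ j / lam (n k i) ∈ Set.Icc (c k) (d k))
    (hincr : ∀ k k', 1 ≤ k → k < k' →
      ∀ a ∈ n k '' Set.Icc 1 (2 ^ k), ∀ b ∈ n k' '' Set.Icc 1 (2 ^ k'), a < b) :
    IsConditionalOperator (diagonalOperator e fun m => (lam m : ℂ)) := by
  rw [one_div] at hα
  have hα0 : 0 < α := (by positivity : (0 : ℝ) < (√2)⁻¹).trans hα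
  obtain ⟨D, hD⟩ := hsup
  have hD' : ∀ k, 1 ≤ k → d k / c k ≤ D := fun k hk => hD ⟨k, hk, rfl⟩
  have hD1 : 1 ≤ D := ((one_le_div (hc 1 le_rfl)).2 (hcd 1 le_rfl)).trans (hD' 1 le_rfl)
  have hmem : ∀ k a, a ∈ (Finset.range (2 ^ k)).image (fun q => n k (2 ^ k - q)) →
      a ∈ n k '' Set.Icc 1 (2 ^ k) := by
    intro k a ha
    obtain ⟨q, hq, rfl⟩ := Finset.mem_image.1 ha
    exact ⟨2 ^ k - q, ⟨by have := Finset.mem_range.1 hq; omega, Nat.sub_le _ _⟩, rfl⟩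
  -- The enumeration is reversed, so that Haar row `q` is carried by the index `n k (2 ^ k - q)`.
  obtain ⟨B, hB1, hB0, hBsize⟩ := exists_dyadicBlocks
    (fun k => (Finset.range (2 ^ k)).image fun q => n k (2 ^ k - q))
    (fun k q => n k (2 ^ k - q)) (fun k hk q hq q' hq' h => by
      simp only [Finset.coe_range, Set.mem_Iio] at hq hq'
      have := hinj k hk (x₁ := 2 ^ k - q) (x₂ := 2 ^ k - q') ⟨by omega, Nat.sub_le _ _⟩
        ⟨by omega, Nat.sub_le _ _⟩ h
      omega)
    (fun _ _ => rfl) (fun k k' a hk hk' ha ha' => by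
      rcases lt_trichotomy k k' with h | h | h
      · exact absurd (hincr k k' hk h a (hmem k a ha) a (hmem k' a ha')) (lt_irrefl a)
      · exact h
      · exact absurd (hincr k' k hk' h a (hmem k' a ha') a (hmem k a ha)) (lt_irrefl a))
  refine B.isConditionalOperator e hlam hα hα' (by linarith) (fun a b hb => ?_) hBsize
  rcases Nat.eq_zero_or_pos (B.size a) with h0 | hk
  · rw [hB0 a h0, Finset.mem_singleton] at hb
    rw [hb, div_self (hlam a).ne', div_self (by positivity), mul_one]
    exact hD1
  · obtain ⟨hrow, hn⟩ := (hB1 a hk).2 a (B.self_mem a)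
    obtain ⟨hrow', hn'⟩ := (hB1 a hk).2 b hb
    have hwa := (pow_div_mem_Icc_of_lt hlast hblock hk hrow).1
    have hwb := (pow_div_mem_Icc_of_lt hlast hblock hk hrow').2
    rw [hn, le_div_iff₀ (hlam a)] at hwa
    rw [hn', div_le_iff₀ (hlam b)] at hwb
    have hck := hc _ hk
    have hdk := hD' _ hk
    rw [div_le_iff₀ hck] at hdk
    -- Multiplying by the level weight gives `α ^ k` for every row of the block, so two rows compare
    -- with only the loss `d k / c k ≤ D`.
    have hlog : ∀ q, q < 2 ^ B.size a → α ^ (B.size a - Nat.log 2 q) * α ^ Nat.log 2 q =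
        α ^ B.size a := by
      intro q hq
      rw [← pow_add, Nat.sub_add_cancel]
      rcases Nat.eq_zero_or_pos q with rfl | hq0
      · simp
      · exact (Nat.log_lt_of_lt_pow hq0.ne' hq).le
    have ha := hlog _ hrow
    have hb' := hlog _ hrow'
    have hla := hlam a
    have hlb := hlam b
    set x := α ^ Nat.log 2 (B.row a)
    set y := α ^ Nat.log 2 (B.row b)
    have hx : 0 < x := by positivity
    have hy : 0 < y := by positivity
    rw [div_le_iff₀ hlb, mul_div_assoc', div_mul_eq_mul_div, le_div_iff₀ hx]
    refine le_of_mul_le_mul_left ?_ hck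
    calc c (B.size a) * (lam a * x) = c (B.size a) * lam a * x := by ring
      _ ≤ α ^ (B.size a - Nat.log 2 (B.row a)) * x := by gcongr
      _ = α ^ (B.size a - Nat.log 2 (B.row b)) * y := by rw [ha, hb']
      _ ≤ d (B.size a) * lam b * y := by gcongr
      _ ≤ D * c (B.size a) * lam b * y := by gcongr
      _ = _ := by ring
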